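/- Let $(a)_k=a(a+1)\cdots(a+k-1)$ denote the rising factorial. Both of the series below converge (absolutely), and \[ \sum_{k=0}^{\infty}\frac{(\frac12)_k^2}{k!^2}\,(2\sqrt2-2)^k\;\cdot\;\sum_{k=0}^{\infty}\frac{(\frac12)_k^2}{k!^2}\,(2\sqrt2-2)^k\left[(3\sqrt2-4)k+\sqrt2-\tfrac32\right]=\frac1\pi . \] Correspondingly, let $d_0\ge 0$ with $d_0^2=2\sqrt2-2$, $s_0=\sqrt{d_0}$, $b_0=3\sqrt2-4$, $a_0=\sqrt2-\frac32$, $c_0=b_0/(1-d_0^2)$, $r_0=a_0+\frac12c_0d_0^2$ and $t_0=r_0$. Then \[ d_0=s_0^2=\sqrt{2\sqrt2-2},\qquad c_0=\sqrt2,\qquad r_0=t_0=\tfrac12, \] and these are initial values for which the following iterations tend to $1/\pi$. Put $d_{n+1}=\dfrac{1-\sqrt{1-d_n^2}}{1+\sqrt{1-d_n^2}}$ and $s_{n+1}=\dfrac{1-\sqrt[4]{1-s_n^4}}{1+\sqrt[4]{1-s_n^4}}$ for $n\ge0$. 1. If $b_{n+1}=2b_n\dfrac{(1+d_{n+1})^3}{1-d_{n+1}}$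 and $a_{n+1}=a_n(1+d_{n+1})^2+\dfrac{b_{n+1}d_{n+1}}{2(1+d_{n+1})}$, then $a_n\to1/\pi$. 2. If (simplified version, starting from the same $a_0$) $a_{n+1}=a_n(1+d_{n+1})^2+c_0\,2^n d_{n+1}(1-d_{n+1})$, then $a_n\to1/\pi$. 3. (Borweins' quadratic iteration) If $r_{n+1}=r_n(1+d_{n+1})^2-c_0\,2^n d_{n+1}$, then $r_n\to1/\pi$. 4. (Borweins' quartic iteration) If $t_{n+1}=(1+s_{n+1})^4t_n-c_0\,2^{2n+1}s_{n+1}(1+s_{n+1}+s_{n+1}^2)$, then $t_n\to1/\pi$. -/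

import Mathlib

namespace BorweinPi

noncomputable section

/-- The coefficient `(1/2)_k ^ 2 / (k!) ^ 2`, where `(a)_k = a (a + 1) ⋯ (a + k - 1)`. -/
def coeff (k : ℕ) : ℝ :=
  ((ascPochhammer ℝ k).eval (1 / 2 : ℝ)) ^ 2 / (Nat.factorial k : ℝ) ^ 2

/-- `d_{n+1} = (1 - √(1 - d_n ^ 2)) / (1 + √(1 - d_n ^ 2))`, started at `d₀`. -/
def dSeq (d₀ : ℝ) : ℕ → ℝ
  | 0 => d₀
  | n + 1 => (1 - √(1 - dSeq d₀ n ^ 2)) / (1 + √(1 - dSeq d₀ n ^ 2))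

/-- `b_{n+1} = 2 b_n (1 + d_{n+1}) ^ 3 / (1 - d_{n+1})`, started at `b₀`. -/
def bSeq (d₀ b₀ : ℝ) : ℕ → ℝ
  | 0 => b₀
  | n + 1 => 2 * bSeq d₀ b₀ n * ((1 + dSeq d₀ (n + 1)) ^ 3 / (1 - dSeq d₀ (n + 1)))

/-- `a_{n+1} = a_n (1 + d_{n+1}) ^ 2 + b_{n+1} d_{n+1} / (2 (1 + d_{n+1}))`, started at `a₀`. -/
def aSeq (d₀ b₀ a₀ : ℝ) : ℕ → ℝ
  | 0 => a₀
  | n + 1 => aSeq d₀ b₀ a₀ n * (1 + dSeq d₀ (n + 1)) ^ 2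
      + bSeq d₀ b₀ (n + 1) * dSeq d₀ (n + 1) / (2 * (1 + dSeq d₀ (n + 1)))

/-- The simplified iteration
`a_{n+1} = a_n (1 + d_{n+1}) ^ 2 + c₀ 2 ^ n d_{n+1} (1 - d_{n+1})`, started at `a₀`. -/
def aSimpSeq (d₀ c₀ a₀ : ℝ) : ℕ → ℝ
  | 0 => a₀
  | n + 1 => aSimpSeq d₀ c₀ a₀ n * (1 + dSeq d₀ (n + 1)) ^ 2
      + c₀ * 2 ^ n * dSeq d₀ (n + 1) * (1 - dSeq d₀ (n + 1))

/-- Borweins' quadratic iteration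
`r_{n+1} = r_n (1 + d_{n+1}) ^ 2 - c₀ 2 ^ n d_{n+1}`, started at `r₀`. -/
def rSeq (d₀ c₀ r₀ : ℝ) : ℕ → ℝ
  | 0 => r₀
  | n + 1 => rSeq d₀ c₀ r₀ n * (1 + dSeq d₀ (n + 1)) ^ 2 - c₀ * 2 ^ n * dSeq d₀ (n + 1)

/-- `s_{n+1} = (1 - (1 - s_n ^ 4) ^ (1/4)) / (1 + (1 - s_n ^ 4) ^ (1/4))`, started at `s₀`. -/
def sSeq (s₀ : ℝ) : ℕ → ℝ
  | 0 => s₀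
  | n + 1 => (1 - (1 - sSeq s₀ n ^ 4) ^ (1 / 4 : ℝ)) / (1 + (1 - sSeq s₀ n ^ 4) ^ (1 / 4 : ℝ))

/-- Borweins' quartic iteration
`t_{n+1} = (1 + s_{n+1}) ^ 4 t_n - c₀ 2 ^ (2n+1) s_{n+1} (1 + s_{n+1} + s_{n+1} ^ 2)`,
started at `t₀`. -/
def tSeq (s₀ c₀ t₀ : ℝ) : ℕ → ℝ
  | 0 => t₀
  | n + 1 => (1 + sSeq s₀ (n + 1)) ^ 4 * tSeq s₀ c₀ t₀ n
      - c₀ * 2 ^ (2 * n + 1) * sSeq s₀ (n + 1) * (1 + sSeq s₀ (n + 1) + sSeq s₀ (n + 1) ^ 2)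

end

end BorweinPi

/-! Write F for `hyp`. The identity says F(m)(b m F'(m) + a F(m)) = 1/π at m = 2√2 - 2. The flux P =
x(1 - x)F' satisfies P' = F/4, so P(1 - x)F(x) + P(x)F(1 - x) is constant (`legendre`); its value
1/π comes from Wallis' product through Abel's theorem (`tendsto_flux_one`). Landen's transformation
F(4x/(1 + x)²) = (1 + x)F(x²) (`hyp_landenArg`) at x = √2 - 1 links m to x² = 1 - m, which turns
Legendre's relation into the identity.

Landen's transformation and its derivative also show that the (a, b) iteration preserves F(d²)(b d²
F'(d²) + a F(d²)) (`hyp_mul_aSeq`). Since d_n → 0 so fast that b_n d_n² → 0, a_n tends to the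
initial value of this quantity, which is 1/π. The other iterations reduce to this one: the
simplified sequence equals a_n, r_n differs from it by c₀ 2ⁿ d_n²/2 → 0, and t_n = r_{2n}. -/

open Filter Topology

namespace BorweinPi

/-! ### Power series with bounded coefficients. -/

theorem summable_of_bounded {u : ℕ → ℝ} {C : ℝ} (hu : ∀ k, |u k| ≤ C) {x : ℝ} (hx : |x| < 1) :
    Summable (fun k => u k * x ^ k) := by
  have h : Summable (fun k : ℕ => C * |x| ^ k) :=
    (summable_geometric_of_lt_one (abs_nonneg x) hx).mul_left C
  refine h.of_norm_bounded fun k => ?_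
  rw [Real.norm_eq_abs, abs_mul, abs_pow]
  exact mul_le_mul_of_nonneg_right (hu k) (by positivity)

theorem hasDerivAt_powerSeries {u : ℕ → ℝ} {C : ℝ} (hu : ∀ k, |u k| ≤ C) {x : ℝ} (hx : |x| < 1) :
    HasDerivAt (fun y => ∑' k, u k * y ^ k) (∑' k : ℕ, ((k : ℝ) + 1) * u (k + 1) * x ^ k) x := by
  obtain ⟨r, hxr, hr1⟩ := exists_between hx
  have hr0 : 0 ≤ r := (abs_nonneg x).trans hxr.le
  have hC : 0 ≤ C := (abs_nonneg _).trans (hu 0)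
  have hbound : Summable (fun k : ℕ => C * (k * r ^ (k - 1))) := by
    apply Summable.mul_left
    rw [← summable_nat_add_iff 1]
    have h1 : Summable (fun k : ℕ => (k : ℝ) ^ 1 * r ^ k) :=
      summable_pow_mul_geometric_of_norm_lt_one 1 (by rwa [Real.norm_of_nonneg hr0])
    have h2 := summable_geometric_of_lt_one hr0 hr1
    refine (h1.add h2).congr fun k => ?_
    push_cast [Nat.add_sub_cancel]
    ring
  have key := hasDerivAt_tsum_of_isPreconnected (g := fun k y => u k * y ^ k)
    (g' := fun k y => u k * (k * y ^ (k - 1))) hbound (isOpen_Ioo (a := -r) (b := r))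
    isPreconnected_Ioo (fun k y _ => (hasDerivAt_pow k y).const_mul (u k))
    (fun k y hy => by
      rw [Real.norm_eq_abs, abs_mul, abs_mul, abs_pow, Nat.abs_cast]
      have : |y| ≤ r := (abs_lt.2 hy).le
      have := hu k
      gcongr)
    (abs_lt.1 hxr) (summable_of_bounded hu hx) (abs_lt.1 hxr)
  have hs : Summable (fun k : ℕ => u k * (k * x ^ (k - 1))) :=
    hbound.of_norm_bounded fun k => by
      rw [Real.norm_eq_abs, abs_mul, abs_mul, abs_pow, Nat.abs_cast]
      have := hu k
      gcongr
  rw [hs.tsum_eq_zero_add] at key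
  simp only [Nat.cast_zero, zero_mul, mul_zero, zero_add, Nat.add_sub_cancel] at key
  convert! key using 1
  refine tsum_congr fun k => ?_
  push_cast
  ring

/-- The sequence `u` moved one place to the right, with a zero put in front. -/
def shiftRight (u : ℕ → ℝ) : ℕ → ℝ
  | 0 => 0
  | k + 1 => u k

theorem abs_shiftRight_le {u : ℕ → ℝ} {C : ℝ} (hu : ∀ k, |u k| ≤ C) (k : ℕ) :
    |shiftRight u k| ≤ C := by
  cases k with
  | zero => simpa [shiftRight] using (abs_nonneg _).trans (hu 0)
  | succ k => exact hu k

theorem tsum_shiftRight {u : ℕ → ℝ} {C : ℝ} (hu : ∀ k, |u k| ≤ C) {x : ℝ} (hx : |x| < 1) :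
    ∑' k, shiftRight u k * x ^ k = x * ∑' k, u k * x ^ k := by
  rw [(summable_of_bounded (abs_shiftRight_le hu) hx).tsum_eq_zero_add, ← tsum_mul_left]
  simp only [shiftRight, zero_mul, zero_add]
  exact tsum_congr fun k => by ring

theorem one_sub_mul_tsum {u : ℕ → ℝ} {C : ℝ} (hu : ∀ k, |u k| ≤ C) {x : ℝ} (hx : |x| < 1) :
    (1 - x) * ∑' k, u k * x ^ k = ∑' k, (u k - shiftRight u k) * x ^ k := by
  simp only [sub_mul]
  rw [(summable_of_bounded hu hx).tsum_sub (summable_of_bounded (abs_shiftRight_le hu) hx),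
    tsum_shiftRight hu hx, one_mul]

/-- Abel's theorem for the coefficients of a power series instead of its partial sums. -/
theorem tendsto_one_sub_mul_tsum {u : ℕ → ℝ} {l : ℝ} (hu : ∃ C, ∀ k, |u k| ≤ C)
    (h : Tendsto u atTop (𝓝 l)) :
    Tendsto (fun x => (1 - x) * ∑' k, u k * x ^ k) (𝓝[<] 1) (𝓝 l) := by
  obtain ⟨C, hC⟩ := hu
  -- Multiplying by 1 - x differences the coefficients, and the partial sums of the differences
  -- telescope back to `u`, so the usual Abel theorem applies.
  have hsum : ∀ n, ∑ k ∈ Finset.range (n + 1), (u k - shiftRight u k) = u n := by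
    intro n
    induction n with
    | zero => simp [shiftRight]
    | succ n ih => rw [Finset.sum_range_succ, ih]; simp [shiftRight]
  have h1 : Tendsto (fun n => ∑ k ∈ Finset.range n, (u k - shiftRight u k)) atTop (𝓝 l) := by
    rw [← tendsto_add_atTop_iff_nat 1]
    simpa only [hsum] using h
  refine (Real.tendsto_tsum_powerSeries_nhdsWithin_lt h1).congr' ?_
  filter_upwards [Ioo_mem_nhdsLT (show (0 : ℝ) < 1 by norm_num)] with x hx
  rw [one_sub_mul_tsum hC]
  rw [abs_of_pos hx.1]
  exact hx.2

/-! ### The coefficients and Wallis' product. -/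

theorem coeff_zero : coeff 0 = 1 := by simp [coeff]

theorem coeff_succ (k : ℕ) : coeff (k + 1) = coeff k * ((2 * k + 1) / (2 * k + 2)) ^ 2 := by
  have h : (Nat.factorial k : ℝ) ≠ 0 := by positivity
  simp only [coeff, ascPochhammer_succ_eval, Nat.factorial_succ]
  push_cast
  field_simp
  ring

/-- The source of π: it gives the limit of `dcoeff` through Wallis' product. -/
theorem coeff_mul_W (k : ℕ) : coeff k * ((2 * k + 1) * Real.Wallis.W k) = 1 := by
  induction k with
  | zero => simp [coeff_zero, Real.Wallis.W]
  | succ k ih =>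
    rw [coeff_succ, Real.Wallis.W_succ]
    refine Eq.trans ?_ ih
    push_cast
    field_simp
    ring

theorem coeff_eq (k : ℕ) : coeff k = (Real.Wallis.W k)⁻¹ * (2 * (k : ℝ) + 1)⁻¹ := by
  have h := coeff_mul_W k
  have hW := (Real.Wallis.W_pos k).ne'
  field_simp
  linarith

theorem coeff_pos (k : ℕ) : 0 < coeff k := by
  rw [coeff_eq]
  have := Real.Wallis.W_pos k
  positivity

/-- The coefficients of the derivative of `∑ coeff k * x ^ k`. -/
noncomputable def dcoeff (k : ℕ) : ℝ := (k + 1) * coeff (k + 1)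

theorem tendsto_inv_two_mul_add_one :
    Tendsto (fun k : ℕ => (2 * (k : ℝ) + 1)⁻¹) atTop (𝓝 0) :=
  tendsto_inv_atTop_zero.comp <| tendsto_atTop_add_const_right _ _ <|
    tendsto_natCast_atTop_atTop.const_mul_atTop two_pos

theorem tendsto_inv_W : Tendsto (fun k => (Real.Wallis.W k)⁻¹) atTop (𝓝 (Real.pi / 2)⁻¹) :=
  Real.Wallis.tendsto_W_nhds_pi_div_two.inv₀ (by positivity)

theorem tendsto_coeff : Tendsto coeff atTop (𝓝 0) := by
  have h := tendsto_inv_W.mul tendsto_inv_two_mul_add_one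
  rw [mul_zero] at h
  exact h.congr fun k => (coeff_eq k).symm

theorem tendsto_dcoeff : Tendsto dcoeff atTop (𝓝 (1 / Real.pi)) := by
  have h1 : Tendsto (fun k : ℕ => (Real.Wallis.W k)⁻¹ * ((1 - (2 * (k : ℝ) + 1)⁻¹) / 2)) atTop
      (𝓝 ((Real.pi / 2)⁻¹ * ((1 - 0) / 2))) :=
    tendsto_inv_W.mul ((tendsto_inv_two_mul_add_one.const_sub 1).div_const 2)
  have h2 : (Real.pi / 2)⁻¹ * ((1 - 0) / 2) = 1 / Real.pi := by
    field_simp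
    norm_num
  rw [h2] at h1
  refine ((tendsto_add_atTop_iff_nat 1).2 h1).congr fun k => ?_
  have hW := (Real.Wallis.W_pos (k + 1)).ne'
  rw [dcoeff, coeff_eq]
  push_cast
  field_simp
  ring

theorem exists_abs_le_of_tendsto {u : ℕ → ℝ} {l : ℝ} (h : Tendsto u atTop (𝓝 l)) :
    ∃ C, ∀ k, |u k| ≤ C := by
  obtain ⟨C, hC⟩ := h.abs.bddAbove_range
  exact ⟨C, fun k => hC ⟨k, rfl⟩⟩

/-- The hypergeometric equation on coefficients: x(1 - x)F' has coefficient `dcoeff k - shiftRight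
dcoeff k` at x^(k+1). -/
theorem add_one_mul_dcoeff_sub (k : ℕ) :
    (k + 1) * (dcoeff k - shiftRight dcoeff k) = coeff k / 4 := by
  cases k with
  | zero => norm_num [dcoeff, shiftRight, coeff_succ, coeff_zero]
  | succ k =>
    simp only [dcoeff, shiftRight]
    rw [coeff_succ (k + 1)]
    push_cast
    field_simp
    ring

/-! ### The hypergeometric function and its flux. -/

/-- The hypergeometric function `₂F₁(1/2, 1/2; 1; x)`. -/
noncomputable def hyp (x : ℝ) : ℝ := ∑' k, coeff k * x ^ k

/-- The derivative of `hyp`. -/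
noncomputable def hypDeriv (x : ℝ) : ℝ := ∑' k, dcoeff k * x ^ k

theorem summable_coeff {x : ℝ} (hx : |x| < 1) : Summable (fun k => coeff k * x ^ k) :=
  (exists_abs_le_of_tendsto tendsto_coeff).elim fun _ h => summable_of_bounded h hx

theorem hasDerivAt_hyp {x : ℝ} (hx : |x| < 1) : HasDerivAt hyp (hypDeriv x) x :=
  (exists_abs_le_of_tendsto tendsto_coeff).elim fun _ h => hasDerivAt_powerSeries h hx

theorem hyp_zero : hyp 0 = 1 := by
  rw [hyp, tsum_eq_single 0 fun k hk => by simp [hk]]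
  simp [coeff_zero]

theorem one_le_hyp {x : ℝ} (h0 : 0 ≤ x) (h1 : x < 1) : 1 ≤ hyp x := by
  have h := (summable_coeff (abs_lt.2 ⟨by linarith, h1⟩)).le_tsum 0
    fun k _ => mul_nonneg (coeff_pos k).le (pow_nonneg h0 k)
  simpa [coeff_zero, hyp] using h

/-- Serves only to make `hypDeriv` continuous at 0. -/
theorem hasDerivAt_hypDeriv_zero : ∃ y, HasDerivAt hypDeriv y 0 :=
  (exists_abs_le_of_tendsto tendsto_dcoeff).elim fun _ h =>
    ⟨_, hasDerivAt_powerSeries h (by simp)⟩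

/-- The flux `x (1 - x) hyp' x` of the hypergeometric equation. -/
noncomputable def flux (x : ℝ) : ℝ := x * ((1 - x) * hypDeriv x)

/-- The hypergeometric equation in self-adjoint form. -/
theorem hasDerivAt_flux {x : ℝ} (hx : |x| < 1) : HasDerivAt flux (hyp x / 4) x := by
  obtain ⟨C, hC⟩ := exists_abs_le_of_tendsto tendsto_dcoeff
  have hq : ∀ k, |dcoeff k - shiftRight dcoeff k| ≤ C + C := fun k =>
    (abs_sub _ _).trans (add_le_add (hC k) (abs_shiftRight_le hC k))
  have h := hasDerivAt_powerSeries (abs_shiftRight_le hq) hx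
  have h2 : ∑' k : ℕ, ((k : ℝ) + 1) * (dcoeff k - shiftRight dcoeff k) * x ^ k = hyp x / 4 := by
    rw [hyp, ← tsum_div_const]
    exact tsum_congr fun k => by rw [add_one_mul_dcoeff_sub]; ring
  change HasDerivAt _
    (∑' k : ℕ, ((k : ℝ) + 1) * (dcoeff k - shiftRight dcoeff k) * x ^ k) x at h
  rw [h2] at h
  refine h.congr_of_eventuallyEq ?_
  filter_upwards [(isOpen_Iio.preimage continuous_abs).mem_nhds hx] with y hy
  rw [tsum_shiftRight hq hy, ← one_sub_mul_tsum hC hy]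
  rfl

theorem tendsto_flux_one : Tendsto flux (𝓝[<] 1) (𝓝 (1 / Real.pi)) := by
  have h := tendsto_one_sub_mul_tsum (exists_abs_le_of_tendsto tendsto_dcoeff) tendsto_dcoeff
  have h2 : Tendsto (fun x : ℝ => x) (𝓝[<] 1) (𝓝 1) := tendsto_id.mono_left nhdsWithin_le_nhds
  have h3 := h2.mul h
  rw [one_mul] at h3
  exact h3

theorem tendsto_one_sub_mul_hyp : Tendsto (fun x => (1 - x) * hyp x) (𝓝[<] 1) (𝓝 0) :=
  tendsto_one_sub_mul_tsum (exists_abs_le_of_tendsto tendsto_coeff) tendsto_coeff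

end BorweinPi

namespace BorweinPi

/-! ### Legendre's relation. -/

theorem eq_of_hasDerivAt_zero_of_tendsto {f : ℝ → ℝ} {a b l : ℝ}
    (hf : ∀ x ∈ Set.Ioo a b, HasDerivAt f 0 x) (hl : Tendsto f (𝓝[>] a) (𝓝 l)) :
    ∀ x ∈ Set.Ioo a b, f x = l := by
  intro x hx
  have hconst : ∀ y ∈ Set.Ioo a b, f y = f x := fun y hy =>
    isOpen_Ioo.is_const_of_deriv_eq_zero isPreconnected_Ioo
      (fun z hz => (hf z hz).differentiableAt.differentiableWithinAt)
      (fun z hz => (hf z hz).deriv) hy hx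
  refine tendsto_nhds_unique (tendsto_const_nhds.congr' ?_) hl
  filter_upwards [Ioo_mem_nhdsGT (hx.1.trans hx.2)] with y hy using (hconst y hy).symm

theorem tendsto_one_sub_nhdsGT_zero : Tendsto (fun x : ℝ => 1 - x) (𝓝[>] 0) (𝓝[<] 1) := by
  refine tendsto_nhdsWithin_of_tendsto_nhds_of_eventually_within _ ?_ ?_
  · have h : ContinuousAt (fun x : ℝ => 1 - x) 0 := by fun_prop
    simpa using h.tendsto.mono_left nhdsWithin_le_nhds
  · filter_upwards [self_mem_nhdsWithin] with x (hx : 0 < x)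
    exact sub_lt_self 1 hx

/-- Legendre's relation. -/
theorem legendre {x : ℝ} (hx : x ∈ Set.Ioo (0 : ℝ) 1) :
    flux (1 - x) * hyp x + flux x * hyp (1 - x) = 1 / Real.pi := by
  refine eq_of_hasDerivAt_zero_of_tendsto
    (f := fun x => flux (1 - x) * hyp x + flux x * hyp (1 - x)) (fun y hy => ?_) ?_ x hx
  · have h1 : |y| < 1 := abs_lt.2 ⟨by linarith [hy.1], hy.2⟩
    have h2 : |1 - y| < 1 := abs_lt.2 ⟨by linarith [hy.2], by linarith [hy.1]⟩
    have hs : HasDerivAt (fun y : ℝ => 1 - y) (-1) y := (hasDerivAt_id y).const_sub 1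
    have := (((hasDerivAt_flux h2).comp y hs).mul (hasDerivAt_hyp h1)).add
      ((hasDerivAt_flux h1).mul ((hasDerivAt_hyp h2).comp y hs))
    refine this.congr_deriv ?_
    simp only [flux, Function.comp]
    ring
  -- As x → 0+, only the first term survives: the second is (1 - x)F'(x) times xF(1 - x), and xF(1 -
  -- x) → 0 because `coeff` tends to 0.
  · have h0 : |(0 : ℝ)| < 1 := by simp
    have hF : Tendsto hyp (𝓝[>] 0) (𝓝 1) := by
      rw [← hyp_zero]
      exact (hasDerivAt_hyp h0).continuousAt.tendsto.mono_left nhdsWithin_le_nhds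
    have hG : Tendsto (fun x => (1 - x) * hypDeriv x) (𝓝[>] 0) (𝓝 ((1 - 0) * hypDeriv 0)) := by
      obtain ⟨_, hd⟩ := hasDerivAt_hypDeriv_zero
      have : ContinuousAt (fun x => (1 - x) * hypDeriv x) 0 :=
        (by fun_prop : ContinuousAt (fun x : ℝ => 1 - x) 0).mul hd.continuousAt
      exact this.tendsto.mono_left nhdsWithin_le_nhds
    have h1 := (tendsto_flux_one.comp tendsto_one_sub_nhdsGT_zero).mul hF
    have h2 := hG.mul (tendsto_one_sub_mul_hyp.comp tendsto_one_sub_nhdsGT_zero)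
    have h3 := h1.add h2
    rw [mul_one, mul_zero, add_zero] at h3
    refine h3.congr fun x => ?_
    simp only [Function.comp, flux]
    ring

/-! ### Landen's transformation. -/

/-- The argument `4 x / (1 + x) ^ 2` of Landen's transformation. -/
noncomputable def landenArg (x : ℝ) : ℝ := 4 * x / (1 + x) ^ 2

theorem one_sub_landenArg {x : ℝ} (hx : 0 < 1 + x) :
    1 - landenArg x = ((1 - x) / (1 + x)) ^ 2 := by
  rw [landenArg]
  field_simp
  ring

theorem landenArg_mem {x : ℝ} (hx : x ∈ Set.Ioo (0 : ℝ) 1) :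
    landenArg x ∈ Set.Ioo (0 : ℝ) 1 := by
  have h0 := hx.1
  have h1 : 0 < 1 - x := sub_pos.2 hx.2
  have h := one_sub_landenArg (x := x) (by linarith)
  have h2 : 0 < ((1 - x) / (1 + x)) ^ 2 := by positivity
  refine ⟨?_, by linarith⟩
  rw [landenArg]
  positivity

theorem abs_landenArg_lt {x : ℝ} (hx : x ∈ Set.Ioo (0 : ℝ) 1) : |landenArg x| < 1 :=
  abs_lt.2 ⟨by linarith [(landenArg_mem hx).1], (landenArg_mem hx).2⟩

theorem hasDerivAt_landenArg {x : ℝ} (hx : 0 < 1 + x) :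
    HasDerivAt landenArg (4 * (1 - x) / (1 + x) ^ 3) x := by
  have h1 : HasDerivAt (fun x : ℝ => 4 * x) 4 x := by
    simpa using (hasDerivAt_id x).const_mul 4
  have h2 : HasDerivAt (fun x : ℝ => (1 + x) ^ 2) (2 * (1 + x)) x := by
    have h := ((hasDerivAt_id x).const_add 1).pow 2
    refine h.congr_deriv ?_
    simp
  refine (h1.div h2 (by positivity)).congr_deriv ?_
  field_simp
  ring

theorem hasDerivAt_hyp_landenArg {x : ℝ} (hx : x ∈ Set.Ioo (0 : ℝ) 1) :
    HasDerivAt (fun x => hyp (landenArg x))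
      (hypDeriv (landenArg x) * (4 * (1 - x) / (1 + x) ^ 3)) x :=
  (hasDerivAt_hyp (abs_landenArg_lt hx)).comp x (hasDerivAt_landenArg (by linarith [hx.1]))

theorem abs_sq_lt_one {x : ℝ} (hx : x ∈ Set.Ioo (0 : ℝ) 1) : |x ^ 2| < 1 := by
  rw [abs_of_nonneg (sq_nonneg x)]
  nlinarith [hx.1, hx.2]

theorem hasDerivAt_sq (x : ℝ) : HasDerivAt (fun x : ℝ => x ^ 2) (2 * x) x := by
  simpa using hasDerivAt_pow 2 x

theorem hasDerivAt_hyp_sq {x : ℝ} (hx : x ∈ Set.Ioo (0 : ℝ) 1) :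
    HasDerivAt (fun x => hyp (x ^ 2)) (hypDeriv (x ^ 2) * (2 * x)) x :=
  HasDerivAt.comp (h := fun x : ℝ => x ^ 2) x (hasDerivAt_hyp (abs_sq_lt_one hx)) (hasDerivAt_sq x)

/-- With p = x(1 - x²), both w = F(4x/(1 + x)²)/(1 + x) and v = F(x²) solve (p y')' = x y. The
differentiated function is p w'; `hasDerivAt_flux_sq` treats p v' in the same way. -/
theorem hasDerivAt_flux_landenArg {x : ℝ} (hx : x ∈ Set.Ioo (0 : ℝ) 1) :
    HasDerivAt (fun x => (1 + x) * flux (landenArg x)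
      - x * (1 - x) / (1 + x) * hyp (landenArg x)) (x * (hyp (landenArg x) / (1 + x))) x := by
  have hx1 : 0 < 1 + x := by linarith [hx.1]
  have h1 : HasDerivAt (fun x : ℝ => 1 + x) 1 x := (hasDerivAt_id x).const_add 1
  have h2 : HasDerivAt (fun x : ℝ => 1 - x) (-1) x := (hasDerivAt_id x).const_sub 1
  have hP := (hasDerivAt_flux (abs_landenArg_lt hx)).comp x (hasDerivAt_landenArg hx1)
  have h := (h1.mul hP).sub
    ((((hasDerivAt_id x).mul h2).div h1 hx1.ne').mul (hasDerivAt_hyp_landenArg hx))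
  refine h.congr_deriv ?_
  simp only [Function.comp, flux, one_sub_landenArg hx1, Pi.mul_apply, Pi.div_apply, id]
  generalize hyp (landenArg x) = u
  generalize hypDeriv (landenArg x) = v
  rw [landenArg]
  field_simp
  ring

theorem hasDerivAt_flux_sq {x : ℝ} (hx : x ∈ Set.Ioo (0 : ℝ) 1) :
    HasDerivAt (fun x => 2 * flux (x ^ 2)) (x * hyp (x ^ 2)) x := by
  refine ((HasDerivAt.comp (h := fun x : ℝ => x ^ 2) x (hasDerivAt_flux (abs_sq_lt_one hx))
    (hasDerivAt_sq x)).const_mul 2).congr_deriv ?_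
  ring

/-- The Wronskian of the two sides of Landen's transformation. -/
noncomputable def landenWronskian (x : ℝ) : ℝ :=
  ((1 + x) * flux (landenArg x) - x * (1 - x) / (1 + x) * hyp (landenArg x)) * hyp (x ^ 2)
    - 2 * flux (x ^ 2) * (hyp (landenArg x) / (1 + x))

theorem hasDerivAt_hyp_landenArg_div {x : ℝ} (hx : x ∈ Set.Ioo (0 : ℝ) 1) :
    HasDerivAt (fun x => hyp (landenArg x) / (1 + x))
      ((hypDeriv (landenArg x) * (4 * (1 - x) / (1 + x) ^ 3) * (1 + x) - hyp (landenArg x) * 1)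
        / (1 + x) ^ 2) x :=
  (hasDerivAt_hyp_landenArg hx).div ((hasDerivAt_id x).const_add 1)
    (by linarith [hx.1])

theorem continuousAt_landenArg_zero : ContinuousAt landenArg 0 :=
  (hasDerivAt_landenArg (by norm_num)).continuousAt

theorem landenArg_zero : landenArg 0 = 0 := by simp [landenArg]

theorem continuousAt_hyp_landenArg_zero : ContinuousAt (fun x => hyp (landenArg x)) 0 := by
  refine ContinuousAt.comp (g := hyp) ?_ continuousAt_landenArg_zero
  rw [landenArg_zero]
  exact (hasDerivAt_hyp (by simp)).continuousAt

theorem continuousAt_hyp_sq_zero : ContinuousAt (fun x => hyp (x ^ 2)) 0 := by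
  refine ContinuousAt.comp (g := hyp) ?_ (by fun_prop)
  exact (hasDerivAt_hyp (by simp)).continuousAt

theorem landenWronskian_eq_zero {x : ℝ} (hx : x ∈ Set.Ioo (0 : ℝ) 1) :
    landenWronskian x = 0 := by
  refine eq_of_hasDerivAt_zero_of_tendsto (f := landenWronskian) (fun y hy => ?_) ?_ x hx
  · have hy1 : 0 < 1 + y := by linarith [hy.1]
    refine (((hasDerivAt_flux_landenArg hy).mul (hasDerivAt_hyp_sq hy)).sub
      ((hasDerivAt_flux_sq hy).mul (hasDerivAt_hyp_landenArg_div hy))).congr_deriv ?_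
    simp only [flux, one_sub_landenArg hy1]
    generalize hyp (landenArg y) = u
    generalize hypDeriv (landenArg y) = v
    rw [landenArg]
    field_simp
    ring
  · have hflux : ContinuousAt flux 0 := (hasDerivAt_flux (by simp)).continuousAt
    have h1 : ContinuousAt (fun x => flux (landenArg x)) 0 := by
      refine ContinuousAt.comp (g := flux) ?_ continuousAt_landenArg_zero
      rwa [landenArg_zero]
    have h2 : ContinuousAt (fun x : ℝ => flux (x ^ 2)) 0 := by
      refine ContinuousAt.comp (g := flux) ?_ (by fun_prop)
      simpa using hflux
    have h3 := continuousAt_hyp_landenArg_zero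
    have h4 := continuousAt_hyp_sq_zero
    have h5 : ContinuousAt (fun x : ℝ => 1 + x) 0 := by fun_prop
    have h6 : ContinuousAt (fun x : ℝ => x * (1 - x)) 0 := by fun_prop
    have h : ContinuousAt landenWronskian 0 :=
      (((h5.mul h1).sub ((h6.div h5 (by norm_num)).mul h3)).mul h4).sub
        ((continuousAt_const.mul h2).mul (h3.div h5 (by norm_num)))
    have h0 : landenWronskian 0 = 0 := by simp [landenWronskian, landenArg_zero, flux]
    have ht := h.tendsto
    rw [h0] at ht
    exact ht.mono_left nhdsWithin_le_nhds

/-- Landen's transformation. -/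
theorem hyp_landenArg {x : ℝ} (hx : x ∈ Set.Ioo (0 : ℝ) 1) :
    hyp (landenArg x) = (1 + x) * hyp (x ^ 2) := by
  have hpos : ∀ y ∈ Set.Ioo (0 : ℝ) 1, 0 < hyp (y ^ 2) := fun y hy =>
    one_pos.trans_le (one_le_hyp (sq_nonneg y) (abs_lt.1 (abs_sq_lt_one hy)).2)
  have h : hyp (landenArg x) / (1 + x) / hyp (x ^ 2) = 1 := by
    refine eq_of_hasDerivAt_zero_of_tendsto
      (f := fun x => hyp (landenArg x) / (1 + x) / hyp (x ^ 2)) (fun y hy => ?_) ?_ x hx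
    · have hy0 := hy.1
      have hy1 : 0 < 1 + y := by linarith
      have hy2 : 0 < 1 - y := sub_pos.2 hy.2
      refine ((hasDerivAt_hyp_landenArg_div hy).div (hasDerivAt_hyp_sq hy)
        (hpos y hy).ne').congr_deriv ?_
      have hW := landenWronskian_eq_zero hy
      simp only [landenWronskian, flux, one_sub_landenArg hy1] at hW
      rw [div_eq_zero_iff]
      left
      -- The weight p = y(1 - y²) turns the numerator of the quotient's derivative into the
      -- Wronskian.
      refine (mul_eq_zero.1 (?_ : y * (1 - y) * (1 + y) * _ = 0)).resolve_left (by positivity)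
      refine Eq.trans ?_ hW
      generalize hyp (landenArg y) = u
      generalize hypDeriv (landenArg y) = v
      rw [landenArg]
      field_simp
      ring
    · have h : ContinuousAt (fun x => hyp (landenArg x) / (1 + x) / hyp (x ^ 2)) 0 :=
        (continuousAt_hyp_landenArg_zero.div (by fun_prop) (by norm_num)).div
          continuousAt_hyp_sq_zero (by simp [hyp_zero])
      have h0 := h.tendsto.mono_left (nhdsWithin_le_nhds (s := Set.Ioi 0))
      simpa [landenArg_zero, hyp_zero] using h0
  have h1 : 0 < 1 + x := by linarith [hx.1]
  have h2 := hpos x hx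
  field_simp at h
  linarith

/-- The derivative of Landen's transformation. -/
theorem landenArg_mul_hypDeriv {x : ℝ} (hx : x ∈ Set.Ioo (0 : ℝ) 1) :
    landenArg x * hypDeriv (landenArg x) =
      x * (1 + x) / (1 - x) * hyp (x ^ 2)
        + 2 * (1 + x) ^ 2 / (1 - x) * (x ^ 2 * hypDeriv (x ^ 2)) := by
  have h1 : HasDerivAt (fun x => (1 + x) * hyp (x ^ 2))
      (1 * hyp (x ^ 2) + (1 + x) * (hypDeriv (x ^ 2) * (2 * x))) x :=
    ((hasDerivAt_id x).const_add 1).mul (hasDerivAt_hyp_sq hx)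
  have h2 := (hasDerivAt_hyp_landenArg hx).congr_of_eventuallyEq
    (f₁ := fun x => (1 + x) * hyp (x ^ 2)) (by
      filter_upwards [isOpen_Ioo.mem_nhds hx] with y hy using (hyp_landenArg hy).symm)
  have h := h2.unique h1
  have hx1 : 0 < 1 + x := by linarith [hx.1]
  have hx2 : 0 < 1 - x := sub_pos.2 hx.2
  have hv : hypDeriv (landenArg x) =
      (1 * hyp (x ^ 2) + (1 + x) * (hypDeriv (x ^ 2) * (2 * x))) * (1 + x) ^ 3
        / (4 * (1 - x)) := by
    rw [← h]
    field_simp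
  rw [hv, landenArg]
  field_simp

end BorweinPi

namespace BorweinPi

/-! ### The series at 2√2 - 2. -/

theorem hasSum_nat_mul_coeff {x : ℝ} (hx : |x| < 1) :
    HasSum (fun k : ℕ => k * coeff k * x ^ k) (x * hypDeriv x) := by
  obtain ⟨C, hC⟩ := exists_abs_le_of_tendsto tendsto_dcoeff
  have h := (summable_of_bounded (abs_shiftRight_le hC) hx).hasSum
  rw [tsum_shiftRight hC hx] at h
  refine h.congr_fun ?_
  intro k
  cases k with
  | zero => simp [shiftRight]
  | succ k => simp [shiftRight, dcoeff]

theorem hasSum_coeff_mul_linear {x : ℝ} (hx : |x| < 1) (b a : ℝ) :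
    HasSum (fun k : ℕ => coeff k * x ^ k * (b * k + a)) (b * (x * hypDeriv x) + a * hyp x) := by
  refine (((hasSum_nat_mul_coeff hx).mul_left b).add
    ((summable_coeff hx).hasSum.mul_left a)).congr_fun fun k => ?_
  ring

theorem sqrt_two_bounds : 1.41 < √2 ∧ √2 < 1.42 := by
  constructor
  · exact Real.lt_sqrt_of_sq_lt (by norm_num)
  · rw [Real.sqrt_lt' (by norm_num)]
    norm_num

theorem abs_two_mul_sqrt_two_sub_two_lt : |2 * √2 - 2| < 1 := by
  obtain ⟨h1, h2⟩ := sqrt_two_bounds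
  exact abs_lt.2 ⟨by linarith, by linarith⟩

theorem landenArg_sqrt_two_sub_one : landenArg (√2 - 1) = 2 * √2 - 2 := by
  have hs : √2 ^ 2 = 2 := Real.sq_sqrt (by norm_num)
  rw [landenArg, add_sub_cancel, hs]
  ring

/-- Ramanujan's series for `1 / π` multiplied by `hyp`, at the argument `2 √2 - 2`. -/
theorem hyp_mul_eq_one_div_pi :
    hyp (2 * √2 - 2) * ((3 * √2 - 4) * ((2 * √2 - 2) * hypDeriv (2 * √2 - 2))
      + (√2 - 3 / 2) * hyp (2 * √2 - 2)) = 1 / Real.pi := by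
  obtain ⟨hlo, hhi⟩ := sqrt_two_bounds
  have hs : √2 ^ 2 = 2 := Real.sq_sqrt (by norm_num)
  have hx : √2 - 1 ∈ Set.Ioo (0 : ℝ) 1 := ⟨by linarith, by linarith⟩
  have hm : 2 * √2 - 2 ∈ Set.Ioo (0 : ℝ) 1 := ⟨by linarith, by linarith⟩
  have hF := hyp_landenArg hx
  have hD := landenArg_mul_hypDeriv hx
  rw [landenArg_sqrt_two_sub_one] at hF hD
  -- The reason for this argument: Landen's pair 4x/(1 + x)² and x² sums to 1, so Legendre's
  -- relation involves only these two points.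
  have hx2 : 1 - (2 * √2 - 2) = (√2 - 1) ^ 2 := by linear_combination -hs
  have hL := legendre hm
  rw [hx2] at hL
  have hne : 1 - (√2 - 1) ≠ 0 := by linarith
  have hc1 : (√2 - 1) * (1 + (√2 - 1)) / (1 - (√2 - 1)) = 1 := by
    rw [div_eq_one_iff_eq hne]
    linear_combination hs
  have hc2 : 2 * (1 + (√2 - 1)) ^ 2 / (1 - (√2 - 1)) = 4 + 2 * √2 := by
    rw [div_eq_iff hne]
    linear_combination 4 * hs
  rw [hc1, hc2] at hD
  rw [hD, hF, ← hL, flux, flux]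
  have hD' : (2 * √2 - 2) * ((1 - (2 * √2 - 2)) * hypDeriv (2 * √2 - 2)) =
      (1 - (2 * √2 - 2)) * (1 * hyp ((√2 - 1) ^ 2)
        + (4 + 2 * √2) * ((√2 - 1) ^ 2 * hypDeriv ((√2 - 1) ^ 2))) := by
    rw [← hD]
    ring
  rw [hD', hF]
  generalize hyp ((√2 - 1) ^ 2) = u
  generalize hypDeriv ((√2 - 1) ^ 2) = v
  generalize √2 = s at hs
  have h3 : s ^ 3 = 2 * s := by linear_combination s * hs
  have h4 : s ^ 4 = 4 := by linear_combination (s ^ 2 + 2) * hs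
  have h5 : s ^ 5 = 4 * s := by linear_combination (s ^ 3 + 2 * s) * hs
  ring_nf
  simp only [hs, h3, h4, h5]
  ring

/-! ### The iterations. -/

section Iteration

variable {d₀ : ℝ}

/-- With w = √(1 - d²), d² = (1 - w)(1 + w): the step inverts Landen's argument, and the bound by d²
gives quadratic convergence. -/
theorem dSeq_step {d : ℝ} (h0 : 0 < d) (h1 : d < 1) :
    (1 - √(1 - d ^ 2)) / (1 + √(1 - d ^ 2)) ∈ Set.Ioo (0 : ℝ) 1 ∧
    (1 - √(1 - d ^ 2)) / (1 + √(1 - d ^ 2)) ≤ d ^ 2 ∧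
    landenArg ((1 - √(1 - d ^ 2)) / (1 + √(1 - d ^ 2))) = d ^ 2 := by
  have hd : 0 < 1 - d ^ 2 := by nlinarith
  have hw : 0 < √(1 - d ^ 2) := Real.sqrt_pos.2 hd
  have hw2 : √(1 - d ^ 2) ^ 2 = 1 - d ^ 2 := Real.sq_sqrt hd.le
  have hw1 : √(1 - d ^ 2) < 1 := by
    rw [Real.sqrt_lt' one_pos]
    nlinarith
  generalize √(1 - d ^ 2) = w at *
  have hd2 : d ^ 2 = (1 - w) * (1 + w) := by linear_combination hw2
  have hw0 : 0 < 1 - w := sub_pos.2 hw1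
  refine ⟨⟨by positivity, ?_⟩, ?_, ?_⟩
  · rw [div_lt_one (by positivity)]
    linarith
  · rw [hd2]
    exact (div_le_self hw0.le (by linarith)).trans (le_mul_of_one_le_right hw0.le (by linarith))
  · rw [landenArg, hd2]
    field_simp
    ring

theorem dSeq_mem (h : d₀ ∈ Set.Ioo (0 : ℝ) 1) (n : ℕ) : dSeq d₀ n ∈ Set.Ioo (0 : ℝ) 1 := by
  induction n with
  | zero => exact h
  | succ n ih => exact (dSeq_step ih.1 ih.2).1

theorem landenArg_dSeq (h : d₀ ∈ Set.Ioo (0 : ℝ) 1) (n : ℕ) :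
    landenArg (dSeq d₀ (n + 1)) = dSeq d₀ n ^ 2 :=
  (dSeq_step (dSeq_mem h n).1 (dSeq_mem h n).2).2.2

theorem dSeq_le_pow (h : d₀ ∈ Set.Ioo (0 : ℝ) 1) (n : ℕ) : dSeq d₀ n ≤ d₀ ^ 2 ^ n := by
  induction n with
  | zero => simp [dSeq]
  | succ n ih =>
    refine (dSeq_step (dSeq_mem h n).1 (dSeq_mem h n).2).2.1.trans ?_
    rw [pow_succ 2 n, pow_mul]
    exact pow_le_pow_left₀ (dSeq_mem h n).1.le ih 2

theorem tendsto_two_pow_mul_dSeq_sq (h : d₀ ∈ Set.Ioo (0 : ℝ) 1) :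
    Tendsto (fun n => 2 ^ n * dSeq d₀ n ^ 2) atTop (𝓝 0) := by
  -- This is N d₀^N → 0 along N = 2ⁿ.
  have h1 : Tendsto (fun n : ℕ => ((2 ^ n : ℕ) : ℝ) * d₀ ^ 2 ^ n) atTop (𝓝 0) :=
    (tendsto_self_mul_const_pow_of_lt_one h.1.le h.2).comp
      (tendsto_pow_atTop_atTop_of_one_lt one_lt_two)
  refine squeeze_zero (fun n => by positivity) (fun n => ?_) h1
  push_cast
  refine mul_le_mul_of_nonneg_left ?_ (by positivity)
  refine le_trans ?_ (dSeq_le_pow h n)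
  exact pow_le_of_le_one (dSeq_mem h n).1.le (dSeq_mem h n).2.le two_ne_zero

theorem tendsto_dSeq_sq (h : d₀ ∈ Set.Ioo (0 : ℝ) 1) :
    Tendsto (fun n => dSeq d₀ n ^ 2) atTop (𝓝 0) := by
  refine squeeze_zero (fun n => by positivity) (fun n => ?_) (tendsto_two_pow_mul_dSeq_sq h)
  exact le_mul_of_one_le_left (by positivity) (one_le_pow₀ one_le_two)

theorem one_sub_dSeq_sq (h : d₀ ∈ Set.Ioo (0 : ℝ) 1) (n : ℕ) :
    1 - dSeq d₀ n ^ 2 = ((1 - dSeq d₀ (n + 1)) / (1 + dSeq d₀ (n + 1))) ^ 2 := by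
  rw [← landenArg_dSeq h, one_sub_landenArg]
  linarith [(dSeq_mem h (n + 1)).1]

theorem bSeq_eq (h : d₀ ∈ Set.Ioo (0 : ℝ) 1) {b₀ c₀ : ℝ} (hb : b₀ = c₀ * (1 - d₀ ^ 2)) (n : ℕ) :
    bSeq d₀ b₀ n = c₀ * 2 ^ n * (1 - dSeq d₀ n ^ 2) := by
  induction n with
  | zero => simpa [bSeq, dSeq] using hb
  | succ n ih =>
    rw [bSeq, ih, one_sub_dSeq_sq h]
    have h0 := (dSeq_mem h (n + 1)).1
    have h1 : 0 < 1 - dSeq d₀ (n + 1) := sub_pos.2 (dSeq_mem h (n + 1)).2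
    generalize dSeq d₀ (n + 1) = x at *
    field_simp
    ring

/-- The quantity preserved by the iteration for `a` and `b`. -/
theorem hyp_mul_aSeq (h : d₀ ∈ Set.Ioo (0 : ℝ) 1) (b₀ a₀ : ℝ) (n : ℕ) :
    hyp (dSeq d₀ n ^ 2) * (bSeq d₀ b₀ n * (dSeq d₀ n ^ 2 * hypDeriv (dSeq d₀ n ^ 2))
      + aSeq d₀ b₀ a₀ n * hyp (dSeq d₀ n ^ 2)) =
    hyp (d₀ ^ 2) * (b₀ * (d₀ ^ 2 * hypDeriv (d₀ ^ 2)) + a₀ * hyp (d₀ ^ 2)) := by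
  induction n with
  | zero => simp [bSeq, aSeq, dSeq]
  | succ n ih =>
    rw [← ih, aSeq, bSeq, ← landenArg_dSeq h n]
    have hx := dSeq_mem h (n + 1)
    -- Everything is now expressed at d_{n+1}²; the recursions for a and b match the coefficients of
    -- F² and F F'.
    rw [landenArg_mul_hypDeriv hx, hyp_landenArg hx]
    have h0 := hx.1
    have h1 : 0 < 1 - dSeq d₀ (n + 1) := sub_pos.2 hx.2
    generalize dSeq d₀ (n + 1) = x at *
    field_simp
    ring

theorem tendsto_aSeq (h : d₀ ∈ Set.Ioo (0 : ℝ) 1) {b₀ c₀ : ℝ} (hb : b₀ = c₀ * (1 - d₀ ^ 2))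
    (a₀ : ℝ) :
    Tendsto (aSeq d₀ b₀ a₀) atTop
      (𝓝 (hyp (d₀ ^ 2) * (b₀ * (d₀ ^ 2 * hypDeriv (d₀ ^ 2)) + a₀ * hyp (d₀ ^ 2)))) := by
  generalize hl : hyp (d₀ ^ 2) * (b₀ * (d₀ ^ 2 * hypDeriv (d₀ ^ 2)) + a₀ * hyp (d₀ ^ 2)) = l
  have hd := tendsto_dSeq_sq h
  have hF : Tendsto (fun n => hyp (dSeq d₀ n ^ 2)) atTop (𝓝 1) := by
    rw [← hyp_zero]
    exact (hasDerivAt_hyp (by simp)).continuousAt.tendsto.comp hd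
  have hG : Tendsto (fun n => hypDeriv (dSeq d₀ n ^ 2)) atTop (𝓝 (hypDeriv 0)) := by
    obtain ⟨_, hd'⟩ := hasDerivAt_hypDeriv_zero
    exact hd'.continuousAt.tendsto.comp hd
  -- The invariant solved for a_n: a_n = (l/F - b_n d_n² F')/F, with F and F' taken at d_n².
  have hlim := (((hF.inv₀ one_ne_zero).const_mul l).sub
    ((((tendsto_two_pow_mul_dSeq_sq h).const_mul c₀).mul (hd.const_sub 1)).mul hG)).mul
      (hF.inv₀ one_ne_zero)
  have hval : (l * 1⁻¹ - c₀ * 0 * (1 - 0) * hypDeriv 0) * 1⁻¹ = l := by norm_num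
  rw [hval] at hlim
  refine hlim.congr fun n => ?_
  have hinv := hyp_mul_aSeq h b₀ a₀ n
  rw [hl, bSeq_eq h hb] at hinv
  have hpos : hyp (dSeq d₀ n ^ 2) ≠ 0 :=
    (one_pos.trans_le (one_le_hyp (sq_nonneg _)
      (abs_lt.1 (abs_sq_lt_one (dSeq_mem h n))).2)).ne'
  rw [← hinv]
  field_simp
  ring

theorem aSimpSeq_eq_aSeq (h : d₀ ∈ Set.Ioo (0 : ℝ) 1) {b₀ c₀ : ℝ} (hb : b₀ = c₀ * (1 - d₀ ^ 2))
    (a₀ : ℝ) (n : ℕ) : aSimpSeq d₀ c₀ a₀ n = aSeq d₀ b₀ a₀ n := by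
  induction n with
  | zero => rfl
  | succ n ih =>
    rw [aSimpSeq, aSeq, ih, bSeq_eq h hb]
    have h0 := (dSeq_mem h (n + 1)).1
    field_simp
    ring

theorem rSeq_eq_aSimpSeq_add (h : d₀ ∈ Set.Ioo (0 : ℝ) 1) (c₀ a₀ : ℝ) (n : ℕ) :
    rSeq d₀ c₀ (a₀ + c₀ * 2⁻¹ * d₀ ^ 2) n =
      aSimpSeq d₀ c₀ a₀ n + c₀ * 2⁻¹ * (2 ^ n * dSeq d₀ n ^ 2) := by
  induction n with
  | zero => simp [rSeq, aSimpSeq, dSeq]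
  | succ n ih =>
    rw [rSeq, aSimpSeq, ih, ← landenArg_dSeq h, landenArg]
    have h0 := (dSeq_mem h (n + 1)).1
    field_simp
    ring

theorem quartic_step {s : ℝ} (h0 : 0 < s) (h1 : s < 1) :
    ∃ u : ℝ, 0 < u ∧ u < 1 ∧ (1 - s ^ 4) ^ (1 / 4 : ℝ) = u ∧ √(1 - (s ^ 2) ^ 2) = u ^ 2 := by
  have hs : 0 < 1 - s ^ 4 := sub_pos.2 (pow_lt_one₀ h0.le h1 (by norm_num))
  have hs1 : 1 - s ^ 4 < 1 := sub_lt_self 1 (by positivity)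
  refine ⟨_, Real.rpow_pos_of_pos hs _, Real.rpow_lt_one hs.le hs1 (by norm_num), rfl, ?_⟩
  rw [← pow_mul, ← Real.rpow_natCast (_ ^ _) 2, ← Real.rpow_mul hs.le, Real.sqrt_eq_rpow]
  norm_num

/-- With u = (1 - s⁴)^(1/4), the first square root is u² and the second is 2u/(1 + u²), so two
quadratic steps are rational in u and make one quartic step. -/
theorem dSeq_two_steps {s : ℝ} (h0 : 0 < s) (h1 : s < 1) {n m : ℕ} {s₀ : ℝ}
    (hs : sSeq s₀ m = s) (hd : dSeq d₀ n = s ^ 2) :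
    0 < sSeq s₀ (m + 1) ∧ sSeq s₀ (m + 1) < 1 ∧
    dSeq d₀ (n + 1) = 2 * sSeq s₀ (m + 1) / (1 + sSeq s₀ (m + 1) ^ 2) ∧
    dSeq d₀ (n + 2) = sSeq s₀ (m + 1) ^ 2 := by
  obtain ⟨u, hu0, hu1, hu, hu2⟩ := quartic_step h0 h1
  have hs' : sSeq s₀ (m + 1) = (1 - u) / (1 + u) := by rw [sSeq, hs, hu]
  have hd1 : dSeq d₀ (n + 1) = (1 - u ^ 2) / (1 + u ^ 2) := by rw [dSeq, hd, hu2]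
  have hsqrt : √(1 - dSeq d₀ (n + 1) ^ 2) = 2 * u / (1 + u ^ 2) := by
    rw [Real.sqrt_eq_iff_mul_self_eq_of_pos (by positivity), hd1]
    field_simp
    ring
  have hpos : 0 < 1 - u := sub_pos.2 hu1
  have hsum : (1 + u) ^ 2 + (1 - u) ^ 2 ≠ 0 := by positivity
  refine ⟨?_, ?_, ?_, ?_⟩
  · rw [hs']
    positivity
  · rw [hs', div_lt_one (by positivity)]
    linarith
  · rw [hs', hd1]
    field_simp
    ring
  · rw [dSeq, hsqrt, hs']
    have : 1 + 2 * u / (1 + u ^ 2) ≠ 0 := by positivity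
    have : 1 + u ^ 2 + 2 * u ≠ 0 := by positivity
    field_simp
    ring

theorem tSeq_eq_rSeq {s₀ : ℝ} (h : s₀ ∈ Set.Ioo (0 : ℝ) 1) (c₀ r₀ : ℝ) (n : ℕ) :
    (0 < sSeq s₀ n ∧ sSeq s₀ n < 1 ∧ dSeq (s₀ ^ 2) (2 * n) = sSeq s₀ n ^ 2) ∧
      tSeq s₀ c₀ r₀ n = rSeq (s₀ ^ 2) c₀ r₀ (2 * n) := by
  induction n with
  | zero => exact ⟨⟨h.1, h.2, rfl⟩, rfl⟩
  | succ n ih =>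
    obtain ⟨⟨hs0, hs1, hd⟩, ht⟩ := ih
    obtain ⟨hs0', hs1', hd1, hd2⟩ := dSeq_two_steps hs0 hs1 rfl hd
    refine ⟨⟨hs0', hs1', hd2⟩, ?_⟩
    rw [tSeq, ht, show 2 * (n + 1) = 2 * n + 1 + 1 from rfl, rSeq, rSeq, hd2, hd1]
    generalize sSeq s₀ (n + 1) = y at *
    field_simp
    ring

end Iteration

end BorweinPi

open BorweinPi in
theorem mainTheorem8 :
    -- the identity, with both series convergent
    (Summable (fun k : ℕ => BorweinPi.coeff k * (2 * √2 - 2 : ℝ) ^ k) ∧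
      Summable (fun k : ℕ => BorweinPi.coeff k * (2 * √2 - 2 : ℝ) ^ k *
        ((3 * √2 - 4) * (k : ℝ) + √2 - 3 / 2)) ∧
      (∑' k : ℕ, BorweinPi.coeff k * (2 * √2 - 2 : ℝ) ^ k) *
        (∑' k : ℕ, BorweinPi.coeff k * (2 * √2 - 2 : ℝ) ^ k *
          ((3 * √2 - 4) * (k : ℝ) + √2 - 3 / 2)) = 1 / Real.pi) ∧
    -- the corresponding initial values
    (∀ d₀ s₀ a₀ b₀ c₀ r₀ t₀ : ℝ,
      0 ≤ d₀ → d₀ ^ 2 = 2 * √2 - 2 → s₀ = √d₀ →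
      b₀ = 3 * √2 - 4 → a₀ = √2 - 3 / 2 →
      c₀ = b₀ / (1 - d₀ ^ 2) → r₀ = a₀ + c₀ * 2⁻¹ * d₀ ^ 2 → t₀ = r₀ →
      -- their closed forms
      (d₀ = √(2 * √2 - 2) ∧ s₀ ^ 2 = √(2 * √2 - 2) ∧ c₀ = √2 ∧ r₀ = 1 / 2 ∧ t₀ = 1 / 2) ∧
      -- the iterations started at them tend to `1 / π`
      Filter.Tendsto (BorweinPi.aSeq d₀ b₀ a₀) Filter.atTop (nhds (1 / Real.pi)) ∧
      Filter.Tendsto (BorweinPi.aSimpSeq d₀ c₀ a₀) Filter.atTop (nhds (1 / Real.pi)) ∧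
      Filter.Tendsto (BorweinPi.rSeq d₀ c₀ r₀) Filter.atTop (nhds (1 / Real.pi)) ∧
      Filter.Tendsto (BorweinPi.tSeq s₀ c₀ t₀) Filter.atTop (nhds (1 / Real.pi))) := by
  have hm := abs_two_mul_sqrt_two_sub_two_lt
  have hlin : HasSum (fun k : ℕ => BorweinPi.coeff k * (2 * √2 - 2 : ℝ) ^ k *
      ((3 * √2 - 4) * (k : ℝ) + √2 - 3 / 2)) _ :=
    (hasSum_coeff_mul_linear hm (3 * √2 - 4) (√2 - 3 / 2)).congr_fun fun k => by ring
  refine ⟨⟨summable_coeff hm, hlin.summable, ?_⟩, ?_⟩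
  · rw [hlin.tsum_eq]
    exact hyp_mul_eq_one_div_pi
  · intro d₀ s₀ a₀ b₀ c₀ r₀ t₀ hd0 hd hs hb ha hc hr ht
    obtain ⟨hlo, hhi⟩ := sqrt_two_bounds
    have hsq : √2 ^ 2 = 2 := Real.sq_sqrt (by norm_num)
    have hdmem : d₀ ∈ Set.Ioo (0 : ℝ) 1 := ⟨by nlinarith, by nlinarith⟩
    have hne : 1 - d₀ ^ 2 ≠ 0 := by rw [hd]; linarith
    have hbc : b₀ = c₀ * (1 - d₀ ^ 2) := by rw [hc, div_mul_cancel₀ _ hne]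
    have hd' : d₀ = √(2 * √2 - 2) := by rw [← hd, Real.sqrt_sq hd0]
    have hs2 : s₀ ^ 2 = d₀ := by rw [hs, Real.sq_sqrt hd0]
    have hc' : c₀ = √2 := by
      rw [hc, div_eq_iff hne, hd, hb]
      linear_combination 2 * hsq
    have hr' : r₀ = 1 / 2 := by
      rw [hr, ha, hc', hd]
      linear_combination hsq
    have hsmem : s₀ ∈ Set.Ioo (0 : ℝ) 1 := by
      rw [hs]
      refine ⟨Real.sqrt_pos.2 hdmem.1, ?_⟩
      rw [Real.sqrt_lt' one_pos]
      simpa using hdmem.2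
    have hA : Tendsto (aSeq d₀ b₀ a₀) atTop (𝓝 (1 / Real.pi)) := by
      have h := tendsto_aSeq hdmem hbc a₀
      rwa [hd, hb, ha, hyp_mul_eq_one_div_pi, ← hb, ← ha] at h
    have hA' : Tendsto (aSimpSeq d₀ c₀ a₀) atTop (𝓝 (1 / Real.pi)) :=
      hA.congr fun n => (aSimpSeq_eq_aSeq hdmem hbc a₀ n).symm
    have hR : Tendsto (rSeq d₀ c₀ r₀) atTop (𝓝 (1 / Real.pi)) := by
      have h := hA'.add ((tendsto_two_pow_mul_dSeq_sq hdmem).const_mul (c₀ * 2⁻¹))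
      rw [mul_zero, add_zero] at h
      rw [hr]
      exact h.congr fun n => (rSeq_eq_aSimpSeq_add hdmem c₀ a₀ n).symm
    refine ⟨⟨hd', hs2.trans hd', hc', hr', ht.trans hr'⟩, hA, hA', hR, ?_⟩
    rw [ht]
    refine (hR.comp (tendsto_id.const_mul_atTop' two_pos)).congr fun n => ?_
    have h := (tSeq_eq_rSeq hsmem c₀ r₀ n).2
    rw [hs2] at h
    exact h.symm
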